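/- For a topological space $X$, a set $A\subseteq X$ and a family $\mathcal U$ of subsets of $X$, let $St(A,\mathcal U)=\bigcup\{U\in\mathcal U: U\cap A\neq\emptyset\}$. For a topological property $\mathcal P$, the space $X$ is called star-$\mathcal P$ if for every open cover $\mathcal U$ of $X$ there is a subspace $Y\subseteq X$ with property $\mathcal P$ such that $St(Y,\mathcal U)=X$. A space is Menger if for every sequence $(\mathcal U_n)_{n\in\omega}$ of its open covers there are finite $\mathcal V_n\subseteq\mathcal U_n$ such that $\bigcup_{n}\mathcal V_n$ is an open cover; it has countable spread if all its discrete subspaces are countable; it is Luzin if it is an uncountable Hausdorff space in which every nowhere dense set is countable. Let $\mathbb P\subseteq\mathbb R$ be the subspace of irrational numbers, and let $\mathcal K[\mathbb P]$ be the set of all nonempty compact nowhere dense subsets of $\mathbb P$ with the Pixley–Roy topology, which has as a base the sets $[K,U]=\{A\in\mathcal K[\mathbb P]: K\subseteq A\subseteq U\}$, where $K\in\mathcal K[\mathbb P]$ and $U\supseteq K$ is open in $\mathbb P$. Assume $\mathsf{CH}$ (that is, $2^{\aleph_0}=\aleph_1$). Then $\mathcal K[\mathbb P]$ is a Tychonoff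 star countable spread space that is not star Menger and not star $\sigma$-compact. Moreover, $\mathcal K[\mathbb P]$ has a dense Luzin subspace, and every dense Luzin subspace $L$ of $\mathcal K[\mathbb P]$ is hereditarily Lindelöf. -/

import Mathlib

namespace StarCovering

universe u

/-- The star of a set `A` with respect to a family `𝒰` of sets: the union of all members of `𝒰`
that meet `A`. -/
def star {X : Type u} (A : Set X) (𝒰 : Set (Set X)) : Set X :=
  ⋃₀ {U | U ∈ 𝒰 ∧ (U ∩ A).Nonempty}

/-- `𝒰` is an open cover of the space `X`. -/
def IsOpenCover (X : Type u) [TopologicalSpace X] (𝒰 : Set (Set X)) : Prop :=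
  (∀ U ∈ 𝒰, IsOpen U) ∧ ⋃₀ 𝒰 = Set.univ

/-- A space `X` is star-`P` if every open cover `𝒰` of `X` admits a subspace `Y` of `X` with
property `P` whose star with respect to `𝒰` is all of `X`. -/
def IsStarP (P : (Y : Type u) → [TopologicalSpace Y] → Prop)
    (X : Type u) [TopologicalSpace X] : Prop :=
  ∀ 𝒰 : Set (Set X), IsOpenCover X 𝒰 → ∃ Y : Set X, P Y ∧ star Y 𝒰 = Set.univ

/-- The Menger property: from every sequence of open covers one can choose finite subfamilies
which together form an open cover. -/
def IsMenger (X : Type u) [TopologicalSpace X] : Prop :=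
  ∀ 𝒰 : ℕ → Set (Set X), (∀ n, IsOpenCover X (𝒰 n)) →
    ∃ 𝒱 : ℕ → Set (Set X), (∀ n, 𝒱 n ⊆ 𝒰 n ∧ (𝒱 n).Finite) ∧ IsOpenCover X (⋃ n, 𝒱 n)

/-- The spread of `X`: the supremum of the cardinalities of discrete subspaces of `X`,
but at least `ℵ₀`. -/
noncomputable def spread (X : Type u) [TopologicalSpace X] : Cardinal.{u} :=
  max Cardinal.aleph0 (⨆ D : {D : Set X // DiscreteTopology D}, Cardinal.mk D.1)

/-- `X` has countable spread. -/
def HasCountableSpread (X : Type u) [TopologicalSpace X] : Prop :=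
  spread X = Cardinal.aleph0

/-- A Luzin space: an uncountable Hausdorff space all of whose nowhere dense subsets are
countable. -/
def IsLuzin (X : Type u) [TopologicalSpace X] : Prop :=
  T2Space X ∧ Uncountable X ∧ ∀ A : Set X, IsNowhereDense A → A.Countable

/-- The type of members of a family `𝒦` of subsets of `X`, to be endowed with the
Pixley–Roy topology. -/
def PixleyRoy {X : Type u} (𝒦 : Set (Set X)) : Type u :=
  {K : Set X // K ∈ 𝒦}

namespace PixleyRoy

variable {X : Type u} {𝒦 : Set (Set X)}

/-- The set `[K, U] = {A ∈ 𝒦 : K ⊆ A ⊆ U}`. -/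
def box (K : PixleyRoy 𝒦) (U : Set X) : Set (PixleyRoy 𝒦) :=
  {A | K.1 ⊆ A.1 ∧ A.1 ⊆ U}

/-- The sets `[K, U]`, where `K ∈ 𝒦` and `U` is an open neighbourhood of `K`. -/
def boxes [TopologicalSpace X] (𝒦 : Set (Set X)) : Set (Set (PixleyRoy 𝒦)) :=
  {B | ∃ (K : PixleyRoy 𝒦) (U : Set X), IsOpen U ∧ K.1 ⊆ U ∧ B = box K U}

/-- The Pixley–Roy topology. -/
instance [TopologicalSpace X] : TopologicalSpace (PixleyRoy 𝒦) :=
  TopologicalSpace.generateFrom (boxes 𝒦)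

/-- The sets `[K, U]` form a base, and not just a subbase, of the Pixley–Roy topology. -/
theorem isTopologicalBasis_boxes [TopologicalSpace X] :
    TopologicalSpace.IsTopologicalBasis (boxes 𝒦) where
  exists_subset_inter := by
    rintro _ ⟨K, U, hU, -, rfl⟩ _ ⟨L, V, hV, -, rfl⟩ A ⟨⟨h1, h2⟩, ⟨h3, h4⟩⟩
    refine ⟨box A (U ∩ V), ⟨A, U ∩ V, hU.inter hV, Set.subset_inter h2 h4, rfl⟩,
      ⟨subset_rfl, Set.subset_inter h2 h4⟩, ?_⟩
    rintro B ⟨h5, h6⟩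
    exact ⟨⟨h1.trans h5, h6.trans Set.inter_subset_left⟩,
      ⟨h3.trans h5, h6.trans Set.inter_subset_right⟩⟩
  sUnion_eq := Set.eq_univ_of_forall fun A =>
    ⟨box A Set.univ, ⟨A, Set.univ, isOpen_univ, Set.subset_univ _, rfl⟩,
      subset_rfl, Set.subset_univ _⟩
  eq_generateFrom := rfl

end PixleyRoy

/-- The space `𝒦[X]` of all nonempty compact nowhere dense subsets of `X`, with the
Pixley–Roy topology. -/
abbrev CompactNowhereDense (X : Type u) [TopologicalSpace X] : Type u :=
  PixleyRoy {K : Set X | K.Nonempty ∧ IsCompact K ∧ IsNowhereDense K}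

/-- The space of irrational numbers, as a subspace of the real line. -/
abbrev Irrationals : Type := {x : ℝ // Irrational x}

end StarCovering

/-!
Write `𝒦` for the hyperspace of compact nowhere dense subsets of the irrationals. The boxes
`[K, U]` are clopen, so `𝒦` is Tychonoff. Everything else rests on three properties of `𝒦`.

* It satisfies the countable chain condition (`PixleyRoy.hasCCC`): boxes `[K, W]` and `[L, W]` with
  the same `W` share the point `K ∪ L`, and countably many `W` suffice.
* It is a Baire space without isolated points (`CompactNowhereDense.baireSpace`,
  `CompactNowhereDense.isNowhereDense_singleton`): a sequence of boxes `[Kₙ, Uₙ]` can be shrunk so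
  fast that `⋂ Uₙ` is compact and nowhere dense.
* It has at most `2^ℵ₀` boxes (`PixleyRoy.mk_boxes_le`).

By the countable chain condition each nowhere dense set misses a dense union of countably many
boxes, so `2^ℵ₀` nowhere dense sets are cofinal among all of them. Under `CH`, Luzin's construction
(`exists_dense_isLuzin`) then gives a dense Luzin subspace. A Luzin space with the countable chain
condition is hereditarily Lindelöf (`HasCCC.hereditarilyLindelofSpace`), hence of countable spread,
and the star of a dense subspace with respect to an open cover is the whole space.

For the failure of the star Menger property, take the cover by all sets `[K, univ]`. A Menger family
`Y ⊆ 𝒦` has a union that cannot be all of the irrationals, because the irrationals are not Menger: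
the open covers by the sets `{x | Tⁿ x < k}`, with `T` the Gauss map, admit no finite selection,
as there are continued fractions with arbitrarily fast growing partial quotients
(`Irrationals.exists_forall_le_iterate_gaussMap`). If `x` is outside that union, then `{x}` is
outside the star of `Y`. Since `σ`-compact spaces are Menger, the star `σ`-compact property fails too.
-/

namespace StarCovering

open Set TopologicalSpace Cardinal Topology

universe u

/-! ### Spaces with the countable chain condition -/

/-- The countable chain condition: every family of pairwise disjoint nonempty open sets is
countable. -/
def HasCCC (X : Type u) [TopologicalSpace X] : Prop :=
  ∀ S : Set (Set X), (∀ U ∈ S, IsOpen U ∧ U.Nonempty) → S.PairwiseDisjoint id → S.Countable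

theorem HasCCC.of_dense {X : Type u} [TopologicalSpace X] (h : HasCCC X) {L : Set X}
    (hL : Dense L) : HasCCC L := by
  intro S hS hd
  have hex : ∀ V : S, ∃ O : Set X, IsOpen O ∧ (Subtype.val ⁻¹' O : Set L) = V.1 := fun V =>
    isOpen_induced_iff.1 (hS V.1 V.2).1
  choose O hO hOV using hex
  have hmeet : ∀ V W : S, (O V ∩ O W).Nonempty → V = W := by
    intro V W hVW
    obtain ⟨x, ⟨hxV, hxW⟩, hxL⟩ := hL.inter_open_nonempty _ ((hO V).inter (hO W)) hVW
    refine Subtype.ext (hd.elim_set V.2 W.2 (⟨x, hxL⟩ : L) ?_ ?_)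
    · rw [← hOV V]; exact hxV
    · rw [← hOV W]; exact hxW
  have hne : ∀ V : S, (O V).Nonempty := by
    intro V
    obtain ⟨x, hx⟩ := (hS V.1 V.2).2
    rw [← hOV V] at hx
    exact ⟨x.1, hx⟩
  have hinj : Function.Injective O := fun V W hVW =>
    hmeet V W (by rw [← hVW, inter_self]; exact hne V)
  have hc : (range O).Countable := by
    refine h _ ?_ ?_
    · rintro _ ⟨V, rfl⟩
      exact ⟨hO V, hne V⟩
    · rintro _ ⟨V, rfl⟩ _ ⟨W, rfl⟩ hVW
      refine disjoint_iff_inter_eq_empty.2 (not_nonempty_iff_eq_empty.1 fun hn => hVW ?_)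
      rw [hmeet V W hn]
  exact countable_coe_iff.1 (@Function.Injective.countable _ _ hc.to_subtype
    (rangeFactorization O) (rangeFactorization_injective.2 hinj))

/-- In a space with the countable chain condition every open family has a countable subfamily
whose union is dense in the union of the whole family: refine the family by a maximal disjoint
family of open sets. -/
theorem HasCCC.exists_countable_dense_subfamily {X : Type u} [TopologicalSpace X]
    (h : HasCCC X) (𝒰 : Set (Set X)) (h𝒰 : ∀ U ∈ 𝒰, IsOpen U) :
    ∃ 𝒱 ⊆ 𝒰, 𝒱.Countable ∧ ⋃₀ 𝒰 ⊆ closure (⋃₀ 𝒱) := by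
  obtain ⟨M, hM⟩ := zorn_subset
    {S : Set (Set X) | (∀ V ∈ S, IsOpen V ∧ V.Nonempty ∧ ∃ U ∈ 𝒰, V ⊆ U) ∧
      S.PairwiseDisjoint id} (by
    intro c hc hchain
    refine ⟨⋃₀ c, ⟨?_, ?_⟩, fun s hs => subset_sUnion_of_mem hs⟩
    · rintro V ⟨s, hs, hV⟩
      exact (hc hs).1 V hV
    · exact (pairwiseDisjoint_sUnion hchain.directedOn).2 fun s hs => (hc hs).2)
  have hMc : M.Countable := h M (fun V hV => ⟨(hM.prop.1 V hV).1, (hM.prop.1 V hV).2.1⟩) hM.prop.2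
  choose f hf𝒰 hf using fun V : M => (hM.prop.1 V.1 V.2).2.2
  have := hMc.to_subtype
  refine ⟨range f, range_subset_iff.2 hf𝒰, countable_range f, ?_⟩
  rintro x ⟨U, hU, hxU⟩
  rw [mem_closure_iff]
  intro O hO hxO
  by_contra hemp
  have hdisj : ∀ V ∈ M, Disjoint (O ∩ U) V := by
    intro V hV
    rw [Set.disjoint_left]
    intro y hy hyV
    exact hemp ⟨y, hy.1, f ⟨V, hV⟩, mem_range_self _, hf ⟨V, hV⟩ hyV⟩
  have hins : insert (O ∩ U) M ⊆ M := hM.le_of_ge ⟨by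
      rintro V (rfl | hV)
      · exact ⟨hO.inter (h𝒰 U hU), ⟨x, hxO, hxU⟩, U, hU, inter_subset_right⟩
      · exact hM.prop.1 V hV,
    hM.prop.2.insert fun V hV _ => hdisj V hV⟩ (subset_insert _ _)
  exact (hdisj _ (hins (mem_insert _ _))).ne_of_mem ⟨hxO, hxU⟩ ⟨hxO, hxU⟩ rfl

/-! ### Luzin spaces -/

/-- The points of the union of an open family left over by a countable subfamily with dense
union form a nowhere dense set, so countably many further members suffice. -/
theorem HasCCC.hereditarilyLindelofSpace {X : Type u} [TopologicalSpace X] (h : HasCCC X)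
    (hX : ∀ A : Set X, IsNowhereDense A → A.Countable) : HereditarilyLindelofSpace X := by
  refine ⟨fun s _ => isLindelof_of_countable_subcover fun {ι} U hU hs => ?_⟩
  obtain ⟨𝒱, h𝒱, h𝒱c, hd⟩ := h.exists_countable_dense_subfamily (range U)
    (by rintro _ ⟨i, rfl⟩; exact hU i)
  have hopen : IsOpen (⋃₀ 𝒱) := isOpen_sUnion fun V hV => by
    obtain ⟨i, rfl⟩ := h𝒱 hV
    exact hU i
  have hcount : (s \ ⋃₀ 𝒱).Countable := by
    refine hX _ (IsNowhereDense.mono ?_ (isClosed_isNowhereDense_iff_compl.2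
      ⟨?_, ?_⟩ : IsClosed (frontier (⋃₀ 𝒱)) ∧ IsNowhereDense (frontier (⋃₀ 𝒱))).2)
    · rintro x ⟨hxs, hx⟩
      refine ⟨hd ?_, fun hi => hx (interior_subset hi)⟩
      rw [sUnion_range]
      exact hs hxs
    · exact isClosed_frontier.isOpen_compl
    · rw [← interior_eq_empty_iff_dense_compl]
      rw [← frontier_compl]
      exact interior_frontier hopen.isClosed_compl
  choose g hg using fun V : 𝒱 => h𝒱 V.2
  choose k hk using fun x : (s \ ⋃₀ 𝒱 : Set X) => mem_iUnion.1 (hs x.2.1)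
  have := h𝒱c.to_subtype
  have := hcount.to_subtype
  refine ⟨range g ∪ range k, (countable_range g).union (countable_range k), fun x hx => ?_⟩
  by_cases hxV : x ∈ ⋃₀ 𝒱
  · obtain ⟨V, hV, hxV⟩ := hxV
    exact mem_biUnion (Or.inl (mem_range_self ⟨V, hV⟩)) (by rw [hg]; exact hxV)
  · exact mem_biUnion (Or.inr (mem_range_self ⟨x, hx, hxV⟩)) (hk ⟨x, hx, hxV⟩)

theorem hasCountableSpread_of_hereditarilyLindelof (X : Type u) [TopologicalSpace X]
    [HereditarilyLindelofSpace X] : HasCountableSpread X := by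
  refine max_eq_left (ciSup_le' fun D => ?_)
  have := D.2
  have : LindelofSpace D.1 :=
    isLindelof_iff_lindelofSpace.1 (HereditarilyLindelofSpace.isLindelof D.1)
  exact mk_le_aleph0_iff.2 countable_of_Lindelof_of_discrete

theorem star_eq_univ_of_dense {X : Type u} [TopologicalSpace X] {L : Set X} (hL : Dense L)
    {𝒰 : Set (Set X)} (h𝒰 : IsOpenCover X 𝒰) : star L 𝒰 = Set.univ := by
  refine eq_univ_of_forall fun x => ?_
  obtain ⟨U, hU, hxU⟩ : x ∈ ⋃₀ 𝒰 := h𝒰.2 ▸ mem_univ x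
  exact ⟨U, ⟨hU, hL.inter_open_nonempty U (h𝒰.1 U hU) ⟨x, hxU⟩⟩, hxU⟩

/-- A type of size at most `ℵ₁` carries a well-order with countable initial segments. -/
theorem exists_linearOrder_countable_Iio {ι : Type u} (h : #ι ≤ ℵ₁) :
    ∃ _ : LinearOrder ι, ∀ i : ι, (Iio i).Countable := by
  obtain ⟨_, _, ho⟩ := exists_ord_eq_type_lt ι
  refine ⟨inferInstance, fun i => ?_⟩
  rw [← le_aleph0_iff_set_countable, ← lt_aleph_one_iff]
  exact (mk_Iio_lt i ho).trans_le h

/-- Luzin's construction. If at most `ℵ₁` sets `F i` are cofinal among the nowhere dense sets and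
at most `ℵ₁` sets `O i` form a `π`-base, choose by Baire's theorem a point of `O i` outside all
`F j` with `j < i`. -/
theorem exists_dense_isLuzin {X ι : Type u} [TopologicalSpace X] [BaireSpace X] [T2Space X]
    [Nonempty X] (hX : ∀ x : X, IsNowhereDense {x}) (hι : #ι ≤ ℵ₁) (F O : ι → Set X)
    (hF : ∀ i, IsNowhereDense (F i)) (hFc : ∀ A, IsNowhereDense A → ∃ i, A ⊆ F i)
    (hO : ∀ i, IsOpen (O i) ∧ (O i).Nonempty)
    (hOc : ∀ U : Set X, IsOpen U → U.Nonempty → ∃ i, O i ⊆ U) :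
    ∃ L : Set X, Dense L ∧ IsLuzin L := by
  obtain ⟨_, hc⟩ := exists_linearOrder_countable_Iio hι
  have hex : ∀ i, ∃ x ∈ O i, ∀ j < i, x ∉ F j := by
    intro i
    have hm : IsMeagre (⋃ j ∈ Iio i, F j) :=
      isMeagre_biUnion (hc i) fun j _ => (hF j).isMeagre
    obtain ⟨x, hxO, hx⟩ := (dense_of_mem_residual hm).inter_open_nonempty _ (hO i).1 (hO i).2
    exact ⟨x, hxO, fun j hj hxj => hx (mem_biUnion hj hxj)⟩
  choose x hxO hxF using hex
  have hcount : ∀ A, IsNowhereDense A → (x ⁻¹' A).Countable := by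
    intro A hA
    obtain ⟨j, hj⟩ := hFc A hA
    refine ((hc j).insert j).mono fun i hi => ?_
    rcases lt_trichotomy i j with h | h | h
    · exact Or.inr h
    · exact Or.inl h
    · exact absurd (hj hi) (hxF i j h)
  have hdense : Dense (range x) := by
    rw [dense_iff_inter_open]
    intro U hU hUne
    obtain ⟨i, hi⟩ := hOc U hU hUne
    exact ⟨x i, hi (hxO i), mem_range_self i⟩
  refine ⟨range x, hdense, inferInstance, ?_, ?_⟩
  · rw [← not_countable_iff]
    intro hr
    have hr' : (range x).Countable := countable_coe_iff.1 hr
    -- Were `range x` countable, the index set would be a countable union of countable fibres.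
    have huniv : (univ : Set ι).Countable := by
      refine (hr'.biUnion (t := fun p _ => x ⁻¹' {p}) fun p _ => hcount _ (hX p)).mono ?_
      exact fun i _ => mem_biUnion (mem_range_self i) rfl
    have : Countable ι := countable_univ_iff.1 huniv
    -- Then the whole space is a countable union of nowhere dense sets, against Baire's theorem.
    have hm : IsMeagre (⋃ j, F j) := isMeagre_iUnion fun j => (hF j).isMeagre
    obtain ⟨y, hy⟩ := (dense_of_mem_residual hm).nonempty
    obtain ⟨j, hj⟩ := hFc {y} (hX y)
    exact hy (mem_iUnion.2 ⟨j, hj rfl⟩)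
  · intro A hA
    have h1 := (hcount _ hA.image_val).image x
    refine countable_of_injective_of_countable_image Subtype.val_injective.injOn (h1.mono ?_)
    rintro _ ⟨⟨_, i, rfl⟩, ha, rfl⟩
    exact ⟨i, ⟨_, ha, rfl⟩, rfl⟩

/-- Under `CH`, a Baire space without isolated points that has the countable chain condition
and a base of size at most `2^ℵ₀` has a dense Luzin subspace: by the countable chain condition,
each nowhere dense set misses a dense union of countably many base sets, and there are only
`(2^ℵ₀)^ℵ₀ = ℵ₁` sequences of base sets. -/
theorem exists_dense_isLuzin_of_continuum_eq {X : Type u} [TopologicalSpace X] [BaireSpace X]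
    [T2Space X] [Nonempty X] (hCH : continuum.{u} = ℵ₁) (hX : ∀ x : X, IsNowhereDense {x})
    (hccc : HasCCC X) {ℬ : Set (Set X)} (hℬ : IsTopologicalBasis ℬ) (hne : ∀ B ∈ ℬ, B.Nonempty)
    (hcard : #ℬ ≤ continuum) : ∃ L : Set X, Dense L ∧ IsLuzin L := by
  classical
  have hι : #(ℕ → ℬ) ≤ ℵ₁ := by
    rw [← hCH, mk_arrow, mk_nat, lift_uzero, lift_aleph0, ← continuum_power_aleph0]
    exact power_le_power_right hcard
  let U : (ℕ → ℬ) → Set X := fun s => ⋃ n, (s n).1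
  have hU : ∀ s, IsOpen (U s) := fun s => isOpen_iUnion fun n => hℬ.isOpen (s n).2
  refine exists_dense_isLuzin hX hι (fun s => if Dense (U s) then (U s)ᶜ else ∅)
    (fun s => (s 0).1) ?_ ?_ (fun s => ⟨hℬ.isOpen (s 0).2, hne _ (s 0).2⟩) ?_
  · intro s
    split_ifs with h
    · exact (isClosed_isNowhereDense_iff_compl.2 ⟨by simpa using hU s, by simpa using h⟩).2
    · exact isNowhereDense_empty
  · intro A hA
    have hd : Dense (closure A)ᶜ := interior_eq_empty_iff_dense_compl.1 hA
    obtain ⟨𝒱, h𝒱, h𝒱c, h𝒱d⟩ := hccc.exists_countable_dense_subfamily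
      {B | B ∈ ℬ ∧ B ⊆ (closure A)ᶜ} (fun B hB => hℬ.isOpen hB.1)
    rw [← hℬ.open_eq_sUnion' isClosed_closure.isOpen_compl] at h𝒱d
    have hdense : Dense (⋃₀ 𝒱) := dense_closure.1 (hd.mono h𝒱d)
    have h𝒱ne : 𝒱.Nonempty := by
      obtain ⟨x, V, hV, -⟩ := hdense.nonempty
      exact ⟨V, hV⟩
    obtain ⟨s, rfl⟩ := h𝒱c.exists_eq_range h𝒱ne
    have hs : ∀ n, s n ∈ ℬ ∧ s n ⊆ (closure A)ᶜ := fun n => h𝒱 (mem_range_self n)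
    refine ⟨fun n => ⟨s n, (hs n).1⟩, ?_⟩
    have hUs : U (fun n => ⟨s n, (hs n).1⟩) = ⋃₀ range s := by
      simp [U, sUnion_range]
    rw [hUs, if_pos hdense]
    rintro x hx ⟨_, ⟨n, rfl⟩, hxn⟩
    exact (hs n).2 hxn (subset_closure hx)
  · rintro V hV ⟨x, hx⟩
    obtain ⟨B, hB, -, hBV⟩ := hℬ.exists_subset_of_mem_open hx hV
    exact ⟨fun _ => ⟨B, hB⟩, hBV⟩

/-! ### Menger spaces -/

theorem isMenger_of_sigmaCompact (X : Type u) [TopologicalSpace X] [SigmaCompactSpace X] :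
    IsMenger X := by
  intro 𝒰 h𝒰
  have hex : ∀ n, ∃ T ⊆ 𝒰 n, T.Finite ∧ compactCovering X n ⊆ ⋃₀ T := fun n => by
    obtain ⟨T, hT, hfin, hcov⟩ := (isCompact_compactCovering X n).elim_finite_subcover_image
      (b := 𝒰 n) (c := id) (h𝒰 n).1 (by
        simp only [id, ← sUnion_eq_biUnion, (h𝒰 n).2]
        exact subset_univ _)
    exact ⟨T, hT, hfin, by rwa [sUnion_eq_biUnion]⟩
  choose 𝒱 h𝒱 hfin hcov using hex
  refine ⟨𝒱, fun n => ⟨h𝒱 n, hfin n⟩, ?_, eq_univ_of_forall fun x => ?_⟩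
  · intro U hU
    obtain ⟨n, hn⟩ := mem_iUnion.1 hU
    exact (h𝒰 n).1 U (h𝒱 n hn)
  · obtain ⟨n, hn⟩ := mem_iUnion.1 ((iUnion_compactCovering X).symm ▸ mem_univ x)
    obtain ⟨V, hV, hxV⟩ := hcov n hn
    exact ⟨V, mem_iUnion.2 ⟨n, hV⟩, hxV⟩

theorem IsStarP.mono {P Q : (Y : Type u) → [TopologicalSpace Y] → Prop} {X : Type u}
    [TopologicalSpace X] (hPQ : ∀ (Y : Type u) [TopologicalSpace Y], P Y → Q Y)
    (h : IsStarP P X) : IsStarP Q X := fun 𝒰 h𝒰 =>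
  let ⟨Y, hY, hs⟩ := h 𝒰 h𝒰
  ⟨Y, hPQ _ hY, hs⟩

/-! ### Spaces with a base of clopen sets -/

theorem completelyRegularSpace_of_isTopologicalBasis_isClopen {X : Type u} [TopologicalSpace X]
    {ℬ : Set (Set X)} (hℬ : IsTopologicalBasis ℬ) (hc : ∀ B ∈ ℬ, IsClopen B) :
    CompletelyRegularSpace X := by
  classical
  rw [completelyRegularSpace_iff_isOpen]
  intro x U hU hx
  obtain ⟨B, hB, hxB, hBU⟩ := hℬ.exists_subset_of_mem_open hx hU
  refine ⟨B.piecewise (fun _ => 0) (fun _ => 1), ?_, piecewise_eq_of_mem _ _ _ hxB,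
    fun y hy => piecewise_eq_of_notMem _ _ _ fun h => hy (hBU h)⟩
  exact continuous_piecewise (by simp [(hc B hB).frontier_eq]) continuousOn_const
    continuousOn_const

/-! ### The Pixley–Roy topology -/

namespace PixleyRoy

variable {X : Type u} {𝒦 : Set (Set X)}

theorem self_mem_box {K : PixleyRoy 𝒦} {U : Set X} (h : K.1 ⊆ U) : K ∈ box K U :=
  ⟨subset_rfl, h⟩

theorem box_mono {K L : PixleyRoy 𝒦} {U V : Set X} (hKL : K.1 ⊆ L.1) (hVU : V ⊆ U) :
    box L V ⊆ box K U := fun _ hA => ⟨hKL.trans hA.1, hA.2.trans hVU⟩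

variable [TopologicalSpace X]

theorem isOpen_box {K : PixleyRoy 𝒦} {U : Set X} (hU : IsOpen U) : IsOpen (box K U) := by
  by_cases h : K.1 ⊆ U
  · exact isTopologicalBasis_boxes.isOpen ⟨K, U, hU, h, rfl⟩
  · convert isOpen_empty
    exact eq_empty_of_forall_notMem fun A hA => h (hA.1.trans hA.2)

/-- The boxes `[K, U]` form a neighbourhood base at `K`. -/
theorem exists_box_subset {K : PixleyRoy 𝒦} {O : Set (PixleyRoy 𝒦)} (hO : IsOpen O)
    (hK : K ∈ O) : ∃ U : Set X, IsOpen U ∧ K.1 ⊆ U ∧ box K U ⊆ O := by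
  obtain ⟨_, ⟨L, U, hU, -, rfl⟩, hKL, hsub⟩ :=
    isTopologicalBasis_boxes.exists_subset_of_mem_open hK hO
  exact ⟨U, hU, hKL.2, (box_mono hKL.1 subset_rfl).trans hsub⟩

theorem isClosed_box [T1Space X] (K : PixleyRoy 𝒦) (U : Set X) : IsClosed (box K U) := by
  rw [← isOpen_compl_iff, isOpen_iff_forall_mem_open]
  intro A hA
  by_cases h : K.1 ⊆ A.1
  · refine ⟨box A univ, fun B hB hBU => hA ⟨h, hB.1.trans hBU.2⟩, isOpen_box isOpen_univ,
      self_mem_box (subset_univ _)⟩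
  · obtain ⟨x, hxK, hxA⟩ := not_subset.1 h
    exact ⟨box A {x}ᶜ, fun B hB hBU => hB.2 (hBU.1 hxK) rfl, isOpen_box isOpen_compl_singleton,
      self_mem_box (subset_compl_singleton_iff.2 hxA)⟩

instance t0Space [T1Space X] : T0Space (PixleyRoy 𝒦) where
  t0 := by
    have key : ∀ A B : PixleyRoy 𝒦, Inseparable A B → A.1 ⊆ B.1 := fun A B h =>
      (((inseparable_iff_forall_isOpen.1 h) _ (isOpen_box (K := A) isOpen_univ)).1
        (self_mem_box (subset_univ _))).1
    exact fun A B h => Subtype.ext ((key A B h).antisymm (key B A h.symm))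

instance t35Space [T1Space X] : T35Space (PixleyRoy 𝒦) where
  toCompletelyRegularSpace :=
    completelyRegularSpace_of_isTopologicalBasis_isClopen isTopologicalBasis_boxes <| by
      rintro _ ⟨K, U, hU, -, rfl⟩
      exact ⟨isClosed_box K U, isOpen_box hU⟩

/-- A Pixley–Roy space of compact sets, closed under unions, over a second countable space is
`σ`-centred: colour an open set by a finite union `W` of basic sets such that it contains some box
`[K, W]`. Two boxes `[K, W]` and `[L, W]` share the point `K ∪ L`. -/
theorem hasCCC [SecondCountableTopology X] (hc : ∀ K ∈ 𝒦, IsCompact K)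
    (hu : ∀ K ∈ 𝒦, ∀ L ∈ 𝒦, K ∪ L ∈ 𝒦) : HasCCC (PixleyRoy 𝒦) := by
  intro S hS hd
  have hex : ∀ O : S, ∃ (K : PixleyRoy 𝒦) (T : {T : Set (Set X) // T.Finite ∧
      T ⊆ countableBasis X}), K.1 ⊆ ⋃₀ T.1 ∧ box K (⋃₀ T.1) ⊆ O.1 := by
    intro O
    obtain ⟨K, hK⟩ := (hS O.1 O.2).2
    obtain ⟨U, hU, hKU, hsub⟩ := exists_box_subset (hS O.1 O.2).1 hK
    obtain ⟨T, hT, hfin, hcov⟩ := (hc K.1 K.2).elim_finite_subcover_image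
      (b := {B | B ∈ countableBasis X ∧ B ⊆ U}) (c := id)
      (fun B hB => isOpen_of_mem_countableBasis hB.1) (by
        simp only [id, ← sUnion_eq_biUnion]
        rwa [← (isBasis_countableBasis X).open_eq_sUnion' hU])
    refine ⟨K, ⟨T, hfin, fun B hB => (hT hB).1⟩, by rwa [sUnion_eq_biUnion],
      (box_mono subset_rfl (sUnion_subset fun B hB => (hT hB).2)).trans hsub⟩
  choose K T hKT hsub using hex
  have hinj : Function.Injective T := by
    intro O O' h
    refine Subtype.ext (hd.elim_set O.2 O'.2 (⟨_, hu _ (K O).2 _ (K O').2⟩ : PixleyRoy 𝒦) ?_ ?_)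
    · exact hsub O ⟨subset_union_left, union_subset (hKT O) (h ▸ hKT O')⟩
    · exact hsub O' ⟨subset_union_right, union_subset (h ▸ hKT O) (hKT O')⟩
  have : Countable {T : Set (Set X) // T.Finite ∧ T ⊆ countableBasis X} :=
    (countable_ofPred_finite_subset (countable_countableBasis X)).to_subtype
  exact countable_coe_iff.1 hinj.countable

theorem mk_boxes_le [SecondCountableTopology X] (hc : ∀ K ∈ 𝒦, IsClosed K) :
    #(boxes 𝒦) ≤ continuum := by
  let g : Set (countableBasis X) × Set (countableBasis X) → Set (PixleyRoy 𝒦) := fun p =>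
    {A | (⋃ B ∈ p.1, B.1)ᶜ ⊆ A.1 ∧ A.1 ⊆ ⋃ B ∈ p.2, B.1}
  have hopen : ∀ U : Set X, IsOpen U → ∃ S : Set (countableBasis X), U = ⋃ B ∈ S, B.1 := by
    intro U hU
    refine ⟨{B | B.1 ⊆ U}, subset_antisymm (fun x hx => ?_) (iUnion₂_subset fun B hB => hB)⟩
    obtain ⟨B, hB, hxB, hBU⟩ := (isBasis_countableBasis X).exists_subset_of_mem_open hx hU
    exact mem_biUnion (show ⟨B, hB⟩ ∈ {B : countableBasis X | B.1 ⊆ U} from hBU) hxB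
  have hsub : boxes 𝒦 ⊆ range g := by
    rintro _ ⟨K, U, hU, -, rfl⟩
    obtain ⟨S, hS⟩ := hopen _ (hc K.1 K.2).isOpen_compl
    obtain ⟨T, hT⟩ := hopen U hU
    refine ⟨(S, T), ?_⟩
    simp only [g, ← hS, ← hT, compl_compl]
    rfl
  have hset : #(Set (countableBasis X)) ≤ continuum := by
    rw [mk_set, ← two_power_aleph0]
    exact power_le_power_left two_ne_zero (mk_le_aleph0_iff.2 inferInstance)
  refine (mk_le_mk_of_subset hsub).trans (mk_range_le.trans ?_)
  rw [mk_prod, lift_id, ← continuum_mul_self]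
  exact mul_le_mul' hset hset

end PixleyRoy

/-! ### The hyperspace of compact nowhere dense sets -/

namespace CompactNowhereDense

variable {X : Type u} [TopologicalSpace X]

theorem exists_mem_notMem [T2Space X] (K : CompactNowhereDense X) {U : Set X} (hU : IsOpen U)
    (hne : U.Nonempty) : ∃ x ∈ U, x ∉ K.1 := by
  by_contra! h
  have h1 : U ⊆ interior (closure K.1) := interior_maximal (Set.Subset.trans h subset_closure) hU
  rw [K.2.2.2] at h1
  exact hne.ne_empty (subset_empty_iff.1 h1)

theorem union_mem (K : Set X) (hK : K ∈ {K : Set X | K.Nonempty ∧ IsCompact K ∧ IsNowhereDense K})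
    (L : Set X) (hL : L ∈ {K : Set X | K.Nonempty ∧ IsCompact K ∧ IsNowhereDense K}) :
    K ∪ L ∈ {K : Set X | K.Nonempty ∧ IsCompact K ∧ IsNowhereDense K} :=
  ⟨hK.1.inl, hK.2.1.union hL.2.1, by
    rw [IsNowhereDense, closure_union,
      interior_union_isClosed_of_interior_empty isClosed_closure hL.2.2]
    exact hK.2.2⟩

/-- The point `{x}` of the hyperspace of a space without isolated points. -/
def single [T1Space X] [∀ x : X, (𝓝[≠] x).NeBot] (x : X) : CompactNowhereDense X :=
  ⟨{x}, singleton_nonempty x, isCompact_singleton, by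
    rw [IsNowhereDense, closure_singleton, interior_singleton]⟩

/-- The hyperspace has no isolated points: `K ∪ {x}` lies in `[K, U]` for all `x ∈ U \ K`. -/
theorem isNowhereDense_singleton [T2Space X] [∀ x : X, (𝓝[≠] x).NeBot]
    (K : CompactNowhereDense X) : IsNowhereDense {K} := by
  rw [IsNowhereDense, closure_singleton, ← not_nonempty_iff_eq_empty]
  rintro ⟨L, hL⟩
  obtain rfl : L = K := mem_singleton_iff.1 (interior_subset hL)
  obtain ⟨U, hU, hLU, hsub⟩ := PixleyRoy.exists_box_subset isOpen_interior hL
  obtain ⟨x, hxU, hxL⟩ := exists_mem_notMem L hU (L.2.1.mono hLU)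
  let M : CompactNowhereDense X := ⟨_, union_mem L.1 L.2 _ (single x).2⟩
  have hM : M ∈ PixleyRoy.box L U :=
    ⟨subset_union_left, union_subset hLU (singleton_subset_iff.2 hxU)⟩
  have hML : M = L := mem_singleton_iff.1 (interior_subset (hsub hM))
  have hxM : x ∈ M.1 := Or.inr rfl
  exact hxL (hML ▸ hxM)

/-- The hyperspace of a Polish space is Baire. Inside dense open sets one finds boxes
`[Kₙ, Uₙ]` with `Kₙ ⊆ Kₙ₊₁` and `closure Uₙ₊₁ ⊆ Uₙ`, where `Uₙ₊₁` is covered by finitely many balls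
of radius `1 / (n + 1)` and does not contain the `n`-th basic open set, unless that set is empty.
Then `⋂ Uₙ` is compact and nowhere dense, hence a point of the hyperspace, and it lies in all these boxes. -/
instance baireSpace [PolishSpace X] : BaireSpace (CompactNowhereDense X) := by
  refine ⟨fun f hfo hfd => dense_iff_inter_open.2 fun O hO ⟨K₀, hK₀⟩ => ?_⟩
  obtain ⟨U₀, hU₀, hKU₀, hsub₀⟩ := PixleyRoy.exists_box_subset hO hK₀
  let := upgradeIsCompletelyMetrizable X
  obtain ⟨b, hb⟩ := exists_seq_basis X
  let S := {p : CompactNowhereDense X × Set X // IsOpen p.2 ∧ p.1.1 ⊆ p.2}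
  have step : ∀ (n : ℕ) (p : S), ∃ q : S, p.1.1.1 ⊆ q.1.1.1 ∧ closure q.1.2 ⊆ p.1.2 ∧
      PixleyRoy.box q.1.1 q.1.2 ⊆ f n ∧
      (∃ t : Set X, t.Finite ∧ q.1.2 ⊆ ⋃ y ∈ t, Metric.ball y (1 / (n + 1))) ∧
      ((b n).Nonempty → ¬ b n ⊆ q.1.2) := by
    rintro n ⟨⟨K, U⟩, hU, hKU⟩
    obtain ⟨L, ⟨hKL, hLU⟩, hLf⟩ := (hfd n).inter_open_nonempty _
      (PixleyRoy.isOpen_box (K := K) hU) ⟨K, PixleyRoy.self_mem_box hKU⟩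
    obtain ⟨V, hV, hLV, hVf⟩ := PixleyRoy.exists_box_subset (hfo n) hLf
    obtain ⟨t, -, htfin, hLt⟩ := L.2.2.1.finite_cover_balls
      (Nat.one_div_pos_of_nat (α := ℝ) (n := n))
    obtain ⟨W, hW, hLW, hbW⟩ : ∃ W : Set X, IsOpen W ∧ L.1 ⊆ W ∧ ((b n).Nonempty → ¬ b n ⊆ W) := by
      by_cases hne : (b n).Nonempty
      · obtain ⟨x, hxb, hxL⟩ := exists_mem_notMem L (hb.isOpen (mem_range_self n)) hne
        exact ⟨{x}ᶜ, isOpen_compl_singleton, subset_compl_singleton_iff.2 hxL,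
          fun _ h => h hxb rfl⟩
      · exact ⟨univ, isOpen_univ, subset_univ _, fun h => absurd h hne⟩
    obtain ⟨U', hU', hLU', hcl⟩ := normal_exists_closure_subset L.2.2.1.isClosed
      (((hU.inter hV).inter (isOpen_biUnion fun y (_ : y ∈ t) =>
        Metric.isOpen_ball (x := y) (ε := 1 / ((n : ℝ) + 1)))).inter hW)
      (subset_inter (subset_inter (subset_inter hLU hLV) hLt) hLW)
    have hsub := subset_closure.trans hcl
    exact ⟨⟨(L, U'), hU', hLU'⟩, hKL, fun x hx => (hcl hx).1.1.1,
      (PixleyRoy.box_mono subset_rfl fun x hx => (hsub hx).1.1.2).trans hVf,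
      ⟨t, htfin, fun x hx => (hsub hx).1.2⟩,
      fun hne h => hbW hne (h.trans fun x hx => (hsub hx).2)⟩
  choose g hgK hgcl hgf hgt hgb using step
  let s : ℕ → S := fun n => Nat.rec ⟨(K₀, U₀), hU₀, hKU₀⟩ (fun n p => g n p) n
  have hs : ∀ n, s (n + 1) = g n (s n) := fun n => rfl
  have hK : Monotone fun n => (s n).1.1.1 := monotone_nat_of_le_succ fun n => hgK n (s n)
  have hU : Antitone fun n => (s n).1.2 :=
    antitone_nat_of_succ_le fun n => subset_closure.trans (hgcl n (s n))
  have hKU : ∀ m n, (s m).1.1.1 ⊆ (s n).1.2 := fun m n =>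
    (hK (le_max_left m n)).trans ((s (max m n)).2.2.trans (hU (le_max_right m n)))
  have hclosed : IsClosed (⋂ n, (s n).1.2) := by
    have : ⋂ n, (s n).1.2 = ⋂ n, closure (s n).1.2 :=
      subset_antisymm (iInter_mono fun n => subset_closure)
        (subset_iInter fun n => (iInter_subset _ (n + 1)).trans (hgcl n (s n)))
    rw [this]
    exact isClosed_iInter fun n => isClosed_closure
  have hmem : ⋂ n, (s n).1.2 ∈ {K : Set X | K.Nonempty ∧ IsCompact K ∧ IsNowhereDense K} := by
    refine ⟨K₀.2.1.mono (subset_iInter fun n => hKU 0 n), ?_, ?_⟩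
    · refine TotallyBounded.isCompact_of_isClosed (Metric.totallyBounded_iff.2 fun ε hε => ?_)
        hclosed
      obtain ⟨n, hn⟩ := exists_nat_one_div_lt hε
      obtain ⟨t, htfin, ht⟩ := hgt n (s n)
      exact ⟨t, htfin, ((iInter_subset _ (n + 1)).trans ht).trans
        (iUnion₂_mono fun y _ => Metric.ball_subset_ball hn.le)⟩
    · rw [hclosed.isNowhereDense_iff, ← not_nonempty_iff_eq_empty]
      rintro ⟨x, hx⟩
      obtain ⟨_, ⟨n, rfl⟩, hxb, hbi⟩ := hb.exists_subset_of_mem_open hx isOpen_interior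
      exact hgb n (s n) ⟨x, hxb⟩
        ((hbi.trans interior_subset).trans (iInter_subset _ (n + 1)))
  refine ⟨⟨_, hmem⟩, hsub₀ ⟨subset_iInter fun n => hKU 0 n, iInter_subset _ 0⟩,
    mem_iInter.2 fun n => hgf n (s n) ⟨subset_iInter fun m => hKU (n + 1) m,
      iInter_subset _ (n + 1)⟩⟩

theorem hasCCC [SecondCountableTopology X] : HasCCC (CompactNowhereDense X) :=
  PixleyRoy.hasCCC (fun _ hK => hK.2.1) union_mem

theorem exists_dense_isLuzin [PolishSpace X] [∀ x : X, (𝓝[≠] x).NeBot] [Nonempty X]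
    (hCH : continuum.{u} = ℵ₁) : ∃ L : Set (CompactNowhereDense X), Dense L ∧ IsLuzin L := by
  have : Nonempty (CompactNowhereDense X) := ‹Nonempty X›.map single
  refine exists_dense_isLuzin_of_continuum_eq hCH isNowhereDense_singleton hasCCC
    PixleyRoy.isTopologicalBasis_boxes ?_ (PixleyRoy.mk_boxes_le fun K hK => hK.2.1.isClosed)
  rintro _ ⟨K, U, -, hKU, rfl⟩
  exact ⟨K, PixleyRoy.self_mem_box hKU⟩

theorem hereditarilyLindelofSpace_of_isLuzin [SecondCountableTopology X]
    {L : Set (CompactNowhereDense X)} (hL : Dense L) (h : IsLuzin L) :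
    HereditarilyLindelofSpace L :=
  (hasCCC.of_dense hL).hereditarilyLindelofSpace h.2.2

/-- The compact sets in a Menger family `Y` together form a set with the Menger property, stated
here for increasing open covers: if `W n 0 ⊆ W n 1 ⊆ …` is an open cover of `X` for each `n`, then
each member of `Y` lies in one of suitably chosen sets `W n (f n)`. -/
theorem exists_subset_of_isMenger {Y : Set (CompactNowhereDense X)} (hY : IsMenger Y)
    (W : ℕ → ℕ → Set X) (hW : ∀ n k, IsOpen (W n k)) (hmono : ∀ n, Monotone (W n))
    (hcov : ∀ n x, ∃ k, x ∈ W n k) : ∃ f : ℕ → ℕ, ∀ K ∈ Y, ∃ n, K.1 ⊆ W n (f n) := by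
  obtain ⟨𝒱, h𝒱, hcover⟩ := hY (fun n => {V | IsOpen V ∧ ∃ k, ∀ K ∈ V, K.1.1 ⊆ W n k}) (by
    refine fun n => ⟨fun V hV => hV.1, eq_univ_of_forall fun K => ?_⟩
    obtain ⟨k, hk⟩ := K.1.2.2.1.elim_directed_cover (W n) (hW n)
      (fun x _ => mem_iUnion.2 (hcov n x)) (hmono n).directed_le
    exact ⟨Subtype.val ⁻¹' PixleyRoy.box K.1 (W n k),
      ⟨(PixleyRoy.isOpen_box (hW n k)).preimage continuous_subtype_val,
        k, fun L hL => hL.2⟩, PixleyRoy.self_mem_box hk⟩)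
  have hf : ∀ n, ∃ k, ∀ V ∈ 𝒱 n, ∀ K ∈ V, K.1.1 ⊆ W n k := by
    intro n
    choose! k hk using fun V (hV : V ∈ 𝒱 n) => ((h𝒱 n).1 hV).2
    obtain ⟨m, hm⟩ := ((h𝒱 n).2.image k).bddAbove
    exact ⟨m, fun V hV K hK => (hk V hV K hK).trans (hmono n (hm (mem_image_of_mem k hV)))⟩
  choose f hf using hf
  refine ⟨f, fun K hK => ?_⟩
  obtain ⟨V, hV, hKV⟩ : (⟨K, hK⟩ : Y) ∈ ⋃₀ ⋃ n, 𝒱 n := hcover.2 ▸ mem_univ _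
  obtain ⟨n, hn⟩ := mem_iUnion.1 hV
  exact ⟨n, hf n V hn _ hKV⟩

/-- If `X` is not Menger, as witnessed by increasing open covers `W n`, then its hyperspace is not
star Menger: the union of a Menger family misses a point `x`, and then no set `[K, univ]` that
contains `{x}` meets the family. -/
theorem not_isStarP_isMenger [T1Space X] [∀ x : X, (𝓝[≠] x).NeBot]
    (W : ℕ → ℕ → Set X) (hW : ∀ n k, IsOpen (W n k)) (hmono : ∀ n, Monotone (W n))
    (hcov : ∀ n x, ∃ k, x ∈ W n k) (hf : ∀ f : ℕ → ℕ, ∃ x, ∀ n, x ∉ W n (f n)) :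
    ¬ IsStarP (fun Y _ => IsMenger Y) (CompactNowhereDense X) := by
  intro h
  obtain ⟨Y, hY, hstar⟩ := h (range fun K => PixleyRoy.box K univ)
    ⟨by rintro _ ⟨K, rfl⟩; exact PixleyRoy.isOpen_box isOpen_univ,
      eq_univ_of_forall fun K => ⟨_, mem_range_self K, PixleyRoy.self_mem_box (subset_univ _)⟩⟩
  obtain ⟨f, hfY⟩ := exists_subset_of_isMenger hY W hW hmono hcov
  obtain ⟨x, hx⟩ := hf f
  obtain ⟨_, ⟨⟨K, rfl⟩, L, hLK, hLY⟩, hxK⟩ : single x ∈ star Y _ := hstar ▸ mem_univ _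
  obtain ⟨y, hy⟩ := K.2.1
  obtain rfl : y = x := hxK.1 hy
  obtain ⟨n, hn⟩ := hfY L hLY
  exact hx n (hn (hLK.1 hy))

end CompactNowhereDense

/-! ### The space of irrational numbers -/

namespace Irrationals

instance nhdsNE_neBot (x : Irrationals) : (𝓝[≠] x).NeBot :=
  (nhdsGT_neBot x).mono (nhdsWithin_mono x fun _ hy => ne_of_gt hy)

instance nonempty : Nonempty Irrationals := ⟨⟨_, irrational_sqrt_two⟩⟩

/-- The irrational numbers are homeomorphic to the closed subset
`{(x, y) | y q * (x - q) = 1 for all q}` of the Polish space `ℝ × (ℚ → ℝ)`. -/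
instance polishSpace : PolishSpace Irrationals := by
  let f : Irrationals → ℝ × (ℚ → ℝ) := fun x => (x.1, fun q => (x.1 - q)⁻¹)
  have hne : ∀ (x : Irrationals) (q : ℚ), x.1 - q ≠ 0 := fun x q =>
    sub_ne_zero.2 fun h => x.2 ⟨q, h.symm⟩
  have hf : Continuous f := continuous_subtype_val.prodMk <| continuous_pi fun q =>
    (continuous_subtype_val.sub continuous_const).inv₀ fun x => hne x q
  have hr : range f = ⋂ q : ℚ, {p : ℝ × (ℚ → ℝ) | p.2 q * (p.1 - (q : ℝ)) = 1} := by
    ext ⟨x, y⟩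
    simp only [mem_range, mem_iInter, mem_ofPred_eq]
    constructor
    · rintro ⟨z, hz⟩ q
      obtain ⟨rfl, rfl⟩ := Prod.mk.inj hz
      exact inv_mul_cancel₀ (hne z q)
    · intro h
      refine ⟨⟨x, ?_⟩, Prod.ext rfl (funext fun q => (eq_inv_of_mul_eq_one_left (h q)).symm)⟩
      rintro ⟨q, rfl⟩
      simpa using h q
  have hcl : IsClosed (range f) := by
    rw [hr]
    refine isClosed_iInter fun q => isClosed_eq ?_ continuous_const
    exact ((continuous_apply q).comp continuous_snd).mul (continuous_fst.sub continuous_const)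
  exact IsClosedEmbedding.polishSpace
    ⟨IsEmbedding.of_comp hf continuous_fst IsEmbedding.subtypeVal, hcl⟩

theorem fract_ne_zero (x : Irrationals) : Int.fract x.1 ≠ 0 := fun h =>
  x.2.ne_int ⌊x.1⌋ (sub_eq_zero.1 h)

/-- The Gauss map `x ↦ 1 / fract x`, which shifts continued fraction expansions. -/
noncomputable def gaussMap (x : Irrationals) : Irrationals :=
  ⟨(Int.fract x.1)⁻¹, irrational_inv_iff.2 (irrational_sub_intCast_iff.2 x.2)⟩

theorem continuous_gaussMap : Continuous gaussMap := by
  refine Continuous.subtype_mk (Continuous.inv₀ ?_ fract_ne_zero) _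
  exact continuous_iff_continuousAt.2 fun x =>
    (continuousAt_fract (x.2.ne_int _)).comp continuousAt_subtype_val

/-- Solvability of the recursion for the tails `z n` of the continued fraction
`1 / (a 0 + 1 / (a 1 + ⋯))`. Finitely many of the equations can be solved, starting from the last
one, so compactness of `[0, 1] ^ ℕ` yields a solution of all of them. -/
theorem exists_continuedFraction_tails (a : ℕ → ℝ) (ha : ∀ n, 1 ≤ a n) :
    ∃ z : ℕ → ℝ, (∀ n, z n ∈ Icc (0 : ℝ) 1) ∧ ∀ n, z n * (a n + z (n + 1)) = 1 := by
  let t : ℕ → Set (ℕ → ℝ) := fun n =>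
    (univ.pi fun _ => Icc 0 1) ∩ ⋂ i ∈ Iio n, {z | z i * (a i + z (i + 1)) = 1}
  have hbox : IsCompact (univ.pi fun _ : ℕ => Icc (0 : ℝ) 1) :=
    isCompact_univ_pi fun _ => isCompact_Icc
  have hclosed : ∀ n, IsClosed (t n) := fun n =>
    hbox.isClosed.inter <| isClosed_biInter fun i _ => isClosed_eq
      ((continuous_apply i).mul (continuous_const.add (continuous_apply (i + 1))))
      continuous_const
  have hne : ∀ n, (t n).Nonempty := by
    suffices h : ∀ (n : ℕ) (a : ℕ → ℝ), (∀ n, 1 ≤ a n) → ∃ z : ℕ → ℝ,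
        (∀ n, z n ∈ Icc (0 : ℝ) 1) ∧ ∀ i < n, z i * (a i + z (i + 1)) = 1 by
      intro n
      obtain ⟨z, hz, hza⟩ := h n a ha
      exact ⟨z, fun i _ => hz i, mem_iInter₂.2 hza⟩
    intro n
    induction n with
    | zero => exact fun _ _ => ⟨0, fun _ => ⟨le_rfl, zero_le_one⟩, fun i hi => by omega⟩
    | succ n ih =>
      intro a ha
      obtain ⟨z, hz, hza⟩ := ih (fun n => a (n + 1)) fun n => ha (n + 1)
      have h1 : 1 ≤ a 0 + z 0 := by linarith [ha 0, (hz 0).1]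
      refine ⟨fun i => Nat.casesOn i (a 0 + z 0)⁻¹ z, ?_, ?_⟩
      · rintro (_ | i)
        · exact ⟨inv_nonneg.2 (zero_le_one.trans h1), inv_le_one_of_one_le₀ h1⟩
        · exact hz i
      · rintro (_ | i) hi
        · exact inv_mul_cancel₀ (by positivity)
        · exact hza i (by omega)
  obtain ⟨z, hz⟩ := IsCompact.nonempty_iInter_of_sequence_nonempty_isCompact_isClosed t
    (fun n => inter_subset_inter_right _ (biInter_subset_biInter_left (Iio_subset_Iio n.le_succ)))
    hne (hbox.of_isClosed_subset (hclosed 0) inter_subset_left) hclosed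
  rw [mem_iInter] at hz
  exact ⟨z, fun n => (hz 0).1 n trivial, fun n => mem_iInter₂.1 (hz (n + 1)).2 n n.lt_succ_self⟩

/-- An infinite continued fraction with natural partial quotients is irrational: if a tail is
`p / q` with `0 < p < q`, then the next tail is `(q - a n * p) / p`, with a smaller denominator. -/
theorem irrational_of_continuedFraction_tails (a : ℕ → ℕ) (z : ℕ → ℝ)
    (hz : ∀ n, z n ∈ Ioo (0 : ℝ) 1) (h : ∀ n, z n * (a n + z (n + 1)) = 1) (n : ℕ) :
    Irrational (z n) := by
  have key : ∀ (q : ℕ) (n : ℕ) (p : ℤ), 0 < q → z n ≠ p / q := by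
    intro q
    induction q using Nat.strong_induction_on with
    | _ q ih =>
      intro n p hq hpq
      have hq' : (0 : ℝ) < q := Nat.cast_pos.2 hq
      have hp : (0 : ℝ) < p := by
        have := (hz n).1
        rw [hpq] at this
        exact (div_pos_iff_of_pos_right hq').1 this
      have hpq' : (p : ℝ) < q := by
        have := (hz n).2
        rwa [hpq, div_lt_one hq'] at this
      lift p to ℕ using by exact_mod_cast hp.le
      simp only [Int.cast_natCast] at hp hpq' hpq
      refine ih p (by exact_mod_cast hpq') (n + 1) (q - a n * p) (by exact_mod_cast hp) ?_
      have := h n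
      rw [hpq] at this
      push_cast
      field_simp at this ⊢
      linarith
  rintro ⟨r, hr⟩
  refine key r.den n r.num r.pos ?_
  rw [← hr, Rat.cast_def]

theorem exists_forall_le_iterate_gaussMap (f : ℕ → ℕ) :
    ∃ x : Irrationals, ∀ n, (f n : ℝ) ≤ (gaussMap^[n] x).1 := by
  -- Partial quotients at least `2` keep all tails below `1`.
  let a : ℕ → ℕ := fun n => f n + 2
  have ha : ∀ n, (2 : ℝ) ≤ a n := fun n => by simp [a]
  obtain ⟨z, hz, hza⟩ := exists_continuedFraction_tails (fun n => a n) fun n => by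
    linarith [ha n]
  have hz' : ∀ n, z n ∈ Ioo (0 : ℝ) 1 := by
    intro n
    have h0 : 0 < z n := (hz n).1.lt_of_ne fun h => by
      have := hza n
      rw [← h, zero_mul] at this
      exact zero_ne_one this
    exact ⟨h0, by nlinarith [hza n, ha n, (hz (n + 1)).1]⟩
  have hirr := irrational_of_continuedFraction_tails a z hz' hza
  let y : ℕ → Irrationals := fun n => ⟨a n + z (n + 1), (hirr (n + 1)).natCast_add (a n)⟩
  have hy : ∀ n, gaussMap (y n) = y (n + 1) := by
    intro n
    refine Subtype.ext ?_
    have hfr : Int.fract (a n + z (n + 1)) = z (n + 1) := by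
      rw [Int.fract_natCast_add, Int.fract_eq_self.2 ⟨(hz' _).1.le, (hz' _).2⟩]
    change (Int.fract (a n + z (n + 1)))⁻¹ = a (n + 1) + z (n + 1 + 1)
    rw [hfr]
    exact (eq_inv_of_mul_eq_one_right (hza (n + 1))).symm
  have hit : ∀ n, gaussMap^[n] (y 0) = y n := by
    intro n
    induction n with
    | zero => rfl
    | succ n ih => rw [Function.iterate_succ_apply', ih, hy]
  refine ⟨y 0, fun n => ?_⟩
  rw [hit]
  change (f n : ℝ) ≤ (f n + 2 : ℕ) + z (n + 1)
  push_cast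
  linarith [(hz' (n + 1)).1]

theorem not_isStarP_isMenger :
    ¬ IsStarP (fun Y _ => IsMenger Y) (CompactNowhereDense Irrationals) := by
  refine CompactNowhereDense.not_isStarP_isMenger
    (fun n k => {x | (gaussMap^[n] x).1 < k}) (fun n k => ?_) (fun n k l hkl x hx => ?_)
    (fun n x => exists_nat_gt (gaussMap^[n] x).1) (fun f => ?_)
  · exact isOpen_lt (continuous_subtype_val.comp (continuous_gaussMap.iterate n)) continuous_const
  · exact (show (gaussMap^[n] x).1 < k from hx).trans_le (Nat.cast_le.2 hkl)
  · obtain ⟨x, hx⟩ := exists_forall_le_iterate_gaussMap f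
    exact ⟨x, fun n => not_lt.2 (hx n)⟩

end Irrationals

end StarCovering

theorem mainTheorem2 (hCH : Cardinal.continuum.{0} = Cardinal.aleph.{0} 1) :
    T35Space (StarCovering.CompactNowhereDense StarCovering.Irrationals) ∧
    StarCovering.IsStarP (fun Y _ => StarCovering.HasCountableSpread Y)
      (StarCovering.CompactNowhereDense StarCovering.Irrationals) ∧
    ¬ StarCovering.IsStarP (fun Y _ => StarCovering.IsMenger Y)
      (StarCovering.CompactNowhereDense StarCovering.Irrationals) ∧
    ¬ StarCovering.IsStarP (fun Y _ => SigmaCompactSpace Y)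
      (StarCovering.CompactNowhereDense StarCovering.Irrationals) ∧
    (∃ L : Set (StarCovering.CompactNowhereDense StarCovering.Irrationals),
      Dense L ∧ StarCovering.IsLuzin L) ∧
    (∀ L : Set (StarCovering.CompactNowhereDense StarCovering.Irrationals),
      Dense L → StarCovering.IsLuzin L → HereditarilyLindelofSpace L) := by
  obtain ⟨L, hL, hLuzin⟩ :=
    StarCovering.CompactNowhereDense.exists_dense_isLuzin (X := StarCovering.Irrationals) hCH
  refine ⟨inferInstance, fun 𝒰 h𝒰 => ⟨L, ?_, StarCovering.star_eq_univ_of_dense hL h𝒰⟩,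
    StarCovering.Irrationals.not_isStarP_isMenger, fun h => ?_, ⟨L, hL, hLuzin⟩, fun L hL h =>
      StarCovering.CompactNowhereDense.hereditarilyLindelofSpace_of_isLuzin hL h⟩
  · have := StarCovering.CompactNowhereDense.hereditarilyLindelofSpace_of_isLuzin hL hLuzin
    exact StarCovering.hasCountableSpread_of_hereditarilyLindelof L
  · exact StarCovering.Irrationals.not_isStarP_isMenger
      (h.mono fun Y _ (_ : SigmaCompactSpace Y) => StarCovering.isMenger_of_sigmaCompact Y)
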